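/- Let $F$ and $E$ be Archimedean (real) vector lattices and let $T:F\to E$ be a positive linear operator, i.e. $Tf\ge 0$ whenever $f\ge 0$. Then the following conditions are equivalent: (i) $T$ is order continuous; (ii) there is a topologically majorizing set $G\subset F_+$ such that the restriction $T|_{F_g}$ is order continuous for every $g\in G$; (iii) there is an order dense and topologically majorizing sublattice $H$ of $F$ such that $T|_H$ is order continuous; (iv) there is a topologically dense regular sublattice $H$ of $F$ such that $T|_H$ is order continuous. Terminology. A net $(f_\alpha)$ in a vector lattice $L$ order converges to $f$ if there is $G\subset L$ with $\bigwedge G=0$ such that for every $g\in G$ there is $\alpha_0$ with $|f_\alpha-f|\le g$ for all $\alpha\ge\alpha_0$; an operator is order continuous if it preserves order limits of nets, and for a restriction $T|_H$ to a sublattice $H$ (a linear subspace stable under the lattice operations) order convergence in the domain is that of the vector lattice $H$ itself. An ideal is a solid linear subspace, $I(G)$ is the ideal generated by $G\subset F$, and $F_e=I(\{e\})$ for $e\in F_+$. A net $(f_\alpha)$ in $F$ converges uniformly to $f$ if for some $e\in F_+$ with $f\in F_e$ and every $\varepsilon>0$ there is $\alpha_0$ with $|f-f_\alpha|\le\varepsilon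 e$ for all $\alpha\ge\alpha_0$. A subset of $F$ is closed if it contains the uniform limits of all uniformly convergent nets in it; the closure $\overline{A}$ of $A$ is the intersection of all closed sets containing $A$. The set $A$ is topologically dense if $\overline{A}=F$, and topologically majorizing if $\overline{I(A)}=F$. A sublattice $H\subset F$ is order dense if for every $f>0$ in $F$ there is $h\in H$ with $0<h\le f$, and regular if every nonempty $G\subset H$ whose infimum in $H$ is $0$ also has infimum $0$ in $F$. -/

import Mathlib

universe u v

namespace VecLat

/-! A vector lattice (Riesz space) is a real vector space `F` with a lattice order compatible with
addition and with multiplication by nonnegative scalars, i.e.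
`[AddCommGroup F] [Lattice F] [IsOrderedAddMonoid F] [Module ℝ F] [IsOrderedModule ℝ F]`. -/

/-- `F` is Archimedean: `⋀ₙ (1/n) f = 0` for every `f ∈ F₊`. (Mathlib's `Archimedean` is a
different notion, which fails already for `ℝ²` with the coordinatewise order.) -/
def IsArchimedean (F : Type u) [AddCommGroup F] [Lattice F] [Module ℝ F] : Prop :=
  ∀ f : F, 0 ≤ f → IsGLB (Set.range fun n : ℕ => ((n : ℝ) + 1)⁻¹ • f) 0

section OrderConvergence

variable {F : Type u} [AddCommGroup F] [Lattice F]

/-- A net `x` order converges to `f`: the tails of `|x α - f|` are dominated by a set `G` with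
`⋀ G = 0`. -/
def OrderConverges {ι : Type v} [Preorder ι] (x : ι → F) (f : F) : Prop :=
  ∃ G : Set F, IsGLB G 0 ∧ ∀ g ∈ G, ∃ α₀, ∀ α, α₀ ≤ α → |x α - f| ≤ g

/-- `T` is continuous for the order convergences: it maps every net which order converges to `f`
to a net which order converges to `T f`. Nets indexed by types in the universe of the domain
suffice, because order convergence of a net depends only on its filter of tails. -/
def IsOrderContinuous {E : Type v} [AddCommGroup E] [Lattice E] [Module ℝ F] [Module ℝ E]
    (T : F →ₗ[ℝ] E) : Prop :=
  ∀ (ι : Type u) [Preorder ι] [IsDirected ι (· ≤ ·)] [Nonempty ι] (x : ι → F) (f : F),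
    OrderConverges x f → OrderConverges (fun α => T (x α)) (T f)

end OrderConvergence

/-- A (vector) sublattice: a linear subspace stable under the lattice operations. -/
structure Sublat (F : Type u) [AddCommGroup F] [Lattice F] [Module ℝ F] extends
    Submodule ℝ F where
  sup_mem : ∀ {a b : F}, a ∈ toSubmodule → b ∈ toSubmodule → a ⊔ b ∈ toSubmodule
  inf_mem : ∀ {a b : F}, a ∈ toSubmodule → b ∈ toSubmodule → a ⊓ b ∈ toSubmodule

section Sublattices

variable {F : Type u} [AddCommGroup F] [Lattice F] [Module ℝ F]

/-- The lattice structure that a sublattice inherits from `F`. -/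
instance (H : Sublat F) : Lattice H.toSubmodule :=
  Subtype.lattice (fun _ _ ha hb => H.sup_mem ha hb) (fun _ _ ha hb => H.inf_mem ha hb)

/-- An ideal is a solid sublattice. -/
def Sublat.IsIdeal (H : Sublat F) : Prop :=
  ∀ f g : F, g ∈ H.toSubmodule → |f| ≤ |g| → f ∈ H.toSubmodule

/-- The ideal `I(G)` generated by `G`: the intersection of all ideals that contain `G`. -/
def idealGen (G : Set F) : Sublat F where
  carrier := {f | ∀ I : Sublat F, I.IsIdeal → G ⊆ I.toSubmodule → f ∈ I.toSubmodule}
  add_mem' ha hb I hI hG := I.toSubmodule.add_mem (ha I hI hG) (hb I hI hG)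
  zero_mem' I _ _ := I.toSubmodule.zero_mem
  smul_mem' c _ ha I hI hG := I.toSubmodule.smul_mem c (ha I hI hG)
  sup_mem ha hb I hI hG := I.sup_mem (ha I hI hG) (hb I hI hG)
  inf_mem ha hb I hI hG := I.inf_mem (ha I hI hG) (hb I hI hG)

/-- The principal ideal `F_e = I({e})`. -/
def principalIdeal (e : F) : Sublat F := idealGen {e}

/-- `H` is order dense: `H ∩ (0, f] ≠ ∅` whenever `0 < f`. -/
def Sublat.IsOrderDense (H : Sublat F) : Prop :=
  ∀ f : F, 0 < f → ∃ h ∈ H.toSubmodule, 0 < h ∧ h ≤ f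

/-- `H` is regular: if a (nonempty) `G ⊆ H` has infimum `0` within the ordered space `H`, then it
has infimum `0` in `F`. -/
def Sublat.IsRegular (H : Sublat F) : Prop :=
  ∀ G : Set H.toSubmodule, G.Nonempty → IsGLB G 0 →
    IsGLB ((fun h : H.toSubmodule => (h : F)) '' G) 0

end Sublattices

section UniformConvergence

variable {F : Type u} [AddCommGroup F] [Lattice F] [Module ℝ F]

/-- A net `x` converges uniformly to `f` relative to `e`: `f ∈ F_e`, and for every `ε > 0`
eventually `|f - x α| ≤ ε e`, that is, `‖f - x α‖_e ≤ ε`. -/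
def UniformConvergesRel {ι : Type v} [Preorder ι] (e : F) (x : ι → F) (f : F) : Prop :=
  f ∈ (principalIdeal e).toSubmodule ∧
    ∀ ε : ℝ, 0 < ε → ∃ α₀, ∀ α, α₀ ≤ α → |f - x α| ≤ ε • e

/-- A net converges uniformly to `f` if it does so relative to some `e ∈ F₊`. -/
def UniformConverges {ι : Type v} [Preorder ι] (x : ι → F) (f : F) : Prop :=
  ∃ e : F, 0 ≤ e ∧ UniformConvergesRel e x f

/-- The uniform adherence of `A`: the set of uniform limits of nets in `A`. -/
def uniformAdherence (A : Set F) : Set F :=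
  {f | ∃ (ι : Type u) (_ : Preorder ι) (_ : IsDirected ι (· ≤ ·)) (_ : Nonempty ι) (x : ι → F),
    (∀ α, x α ∈ A) ∧ UniformConverges x f}

/-- `A` is uniformly closed if it equals its adherence. -/
def IsUniformlyClosed (A : Set F) : Prop := uniformAdherence A = A

/-- The uniform closure of `A`: the intersection of all uniformly closed sets that contain `A`. -/
def uniformClosure (A : Set F) : Set F :=
  ⋂₀ {C | IsUniformlyClosed C ∧ A ⊆ C}

/-- `A` is topologically dense for the uniform convergence: its closure is all of `F`. -/
def IsTopologicallyDense (A : Set F) : Prop := uniformClosure A = Set.univ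

/-- `G` is topologically majorizing for the uniform convergence: the ideal it generates is
topologically dense. -/
def IsTopologicallyMajorizing (G : Set F) : Prop :=
  IsTopologicallyDense ((idealGen G).toSubmodule : Set F)

end UniformConvergence

end VecLat

set_option linter.unusedSectionVars false

namespace VecLat

/-! ### Inequalities in lattice-ordered groups. -/

section Lattice

variable {F : Type u} [AddCommGroup F] [Lattice F] [IsOrderedAddMonoid F]

/-! Call `f` absorbed if `⋀ T (d ⊓ |f|) = 0` along every `D` directed downwards to `0`. For positive
`T` the absorbed elements form an ideal, and since `E` is Archimedean this ideal is uniformly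
closed. If it contains a topologically majorizing set it is therefore all of `F`; below a fixed `d₀
∈ D` the infimum with `d₀` changes nothing, so `T` is order continuous. It remains to absorb `G` in
(ii), by cutting `D` down to `d ⊓ g ∈ F_g`, and `H` in (iii), by replacing each `d ⊓ |f|` with the
elements of `H` above it; order density keeps the infimum `0`.

For (iv) → (iii), a topologically dense regular `H` is order dense. One adherence step need not
reach the closure, so Zorn's lemma supplies a maximal sublattice `K ⊇ H` in which `H` is order
dense. Such a `K` inherits regularity from `H`, and a regular sublattice is order dense in its
adherence, so by maximality `K` contains its adherence and equals `F`. -/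

theorem inf_add_le_add_inf {d a b : F} (hd : 0 ≤ d) (ha : 0 ≤ a) (hb : 0 ≤ b) :
    d ⊓ (a + b) ≤ d ⊓ a + d ⊓ b := by
  rw [add_inf, inf_add]
  refine le_inf ?_ (le_trans (inf_le_inf ?_ le_rfl) (inf_add d a b).ge)
  · exact inf_le_left.trans (le_inf (by simpa using hd) (by simpa using ha))
  · simpa using hb

theorem inf_abs_le_inf_abs_add {d : F} (hd : 0 ≤ d) (f a : F) :
    d ⊓ |f| ≤ d ⊓ |a| + |f - a| := by
  have h : |f| ≤ |a| + |f - a| := by simpa using abs_add_le a (f - a)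
  calc d ⊓ |f| ≤ d ⊓ (|a| + |f - a|) := inf_le_inf le_rfl h
    _ ≤ d ⊓ |a| + d ⊓ |f - a| := inf_add_le_add_inf hd (abs_nonneg _) (abs_nonneg _)
    _ ≤ d ⊓ |a| + |f - a| := add_le_add le_rfl inf_le_right

theorem le_of_abs_sub_le_left {f a c : F} (h : |f - a| ≤ c) : f - c ≤ a :=
  sub_le_comm.1 ((le_abs_self _).trans h)

theorem le_of_abs_sub_le_right {f a c : F} (h : |f - a| ≤ c) : a ≤ f + c := by
  have := (neg_le_abs (f - a)).trans h
  rw [neg_sub] at this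
  exact sub_le_iff_le_add'.1 this

theorem abs_sup_le (a b : F) : |a ⊔ b| ≤ |a| + |b| :=
  abs_le'.2 ⟨sup_le ((le_abs_self a).trans (le_add_of_nonneg_right (abs_nonneg b)))
      ((le_abs_self b).trans (le_add_of_nonneg_left (abs_nonneg a))),
    (neg_le_neg le_sup_left).trans
      ((neg_le_abs a).trans (le_add_of_nonneg_right (abs_nonneg b)))⟩

theorem abs_sup_sub_sup_le (a b c d : F) : |a ⊔ b - c ⊔ d| ≤ |a - c| + |b - d| := by
  rw [← sub_add_sub_cancel _ (c ⊔ b)]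
  refine (abs_add_le _ _).trans (add_le_add (abs_sup_sub_sup_le_abs a c b) ?_)
  rw [sup_comm c b, sup_comm c d]
  exact abs_sup_sub_sup_le_abs b d c

theorem directedOn_finset_inf' (G : Set F) :
    DirectedOn (· ≥ ·)
      {d | ∃ (s : Finset F) (hs : s.Nonempty), (s : Set F) ⊆ G ∧ d = s.inf' hs id} := by
  classical
  rintro _ ⟨s, hs, hsG, rfl⟩ _ ⟨t, ht, htG, rfl⟩
  refine ⟨_, ⟨s ∪ t, hs.mono Finset.subset_union_left, by simp [hsG, htG], rfl⟩,
    Finset.inf'_mono _ Finset.subset_union_left _,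
    Finset.inf'_mono _ Finset.subset_union_right _⟩

end Lattice

section Archimedean

variable {F : Type u} [AddCommGroup F] [Lattice F] [IsOrderedAddMonoid F] [Module ℝ F]
  [IsOrderedModule ℝ F]

theorem IsArchimedean.nonpos_of_forall_le (hF : IsArchimedean F) {e x : F} (he : 0 ≤ e)
    (h : ∀ ε : ℝ, 0 < ε → x ≤ ε • e) : x ≤ 0 :=
  (hF e he).2 (by rintro _ ⟨n, rfl⟩; exact h _ (by positivity))

theorem IsArchimedean.nonpos_of_nsmul_le (hF : IsArchimedean F) {e x : F} (he : 0 ≤ e)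
    (h : ∀ n : ℕ, n • x ≤ e) : x ≤ 0 := by
  refine (hF e he).2 ?_
  rintro _ ⟨n, rfl⟩
  have h1 := smul_le_smul_of_nonneg_left (h (n + 1)) (by positivity : (0 : ℝ) ≤ ((n : ℝ) + 1)⁻¹)
  rw [← Nat.cast_smul_eq_nsmul ℝ, smul_smul] at h1
  push_cast at h1
  rwa [inv_mul_cancel₀ (by positivity), one_smul] at h1

theorem abs_smul_le (c : ℝ) (f : F) : |c • f| ≤ |c| • |f| := by
  have key : ∀ g : F, c • g ≤ |c| • |g| := by
    intro g
    rcases le_total 0 c with hc | hc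
    · rw [abs_of_nonneg hc]
      exact smul_le_smul_of_nonneg_left (le_abs_self g) hc
    · rw [abs_of_nonpos hc, ← neg_smul_neg c g]
      exact smul_le_smul_of_nonneg_left (neg_le_abs g) (neg_nonneg.2 hc)
  refine abs_le'.2 ⟨key f, ?_⟩
  have := key (-f)
  rwa [smul_neg, abs_neg] at this

end Archimedean

/-! ### Order continuity of positive maps via downward directed sets. -/

section PositiveMap

variable {F : Type u} {E : Type v} [AddCommGroup F] [Lattice F] [IsOrderedAddMonoid F]
  [AddCommGroup E] [Lattice E] [IsOrderedAddMonoid E] [Module ℝ F] [Module ℝ E]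
  {T : F →ₗ[ℝ] E}

theorem map_mono_of_nonneg (hT : ∀ f : F, 0 ≤ f → 0 ≤ T f) {a b : F} (h : a ≤ b) : T a ≤ T b := by
  have := hT _ (sub_nonneg.2 h)
  rwa [map_sub, sub_nonneg] at this

/-- `D` with reversed order, mapped into `F` by inclusion, is itself a net order converging to `0`.
-/
theorem IsOrderContinuous.nonpos_of_le_map (hT : IsOrderContinuous T) {D : Set F}
    (hne : D.Nonempty) (hdir : DirectedOn (· ≥ ·) D) (hD : IsGLB D 0) {l : E}
    (hl : ∀ d ∈ D, l ≤ T d) : l ≤ 0 := by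
  have : Nonempty (OrderDual D) := hne.to_subtype
  have : IsDirected (OrderDual D) (· ≤ ·) :=
    ⟨fun a b => by
      obtain ⟨c, hc, h1, h2⟩ := hdir _ (OrderDual.ofDual a).2 _ (OrderDual.ofDual b).2
      exact ⟨OrderDual.toDual ⟨c, hc⟩, h1, h2⟩⟩
  obtain ⟨G, hG, hG'⟩ := hT (OrderDual D) (fun d => ((OrderDual.ofDual d : D) : F)) 0
    ⟨D, hD, fun g hg => ⟨OrderDual.toDual ⟨g, hg⟩, fun d hd => by
      rw [sub_zero, abs_of_nonneg (hD.1 (OrderDual.ofDual d).2)]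
      exact hd⟩⟩
  refine hG.2 fun g hg => ?_
  obtain ⟨d, hd⟩ := hG' g hg
  have := hd d le_rfl
  rw [map_zero, sub_zero] at this
  exact (hl _ (OrderDual.ofDual d).2).trans ((le_abs_self _).trans this)

theorem isOrderContinuous_of_directed (hT : ∀ f : F, 0 ≤ f → 0 ≤ T f)
    (h : ∀ D : Set F, D.Nonempty → DirectedOn (· ≥ ·) D → IsGLB D 0 →
      ∀ l : E, (∀ d ∈ D, l ≤ T d) → l ≤ 0) : IsOrderContinuous T := by
  classical
  rintro ι _ _ _ x f ⟨G, hG, hx⟩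
  -- `⋀ ∅ = 0` is possible only in the zero space.
  rcases G.eq_empty_or_nonempty with rfl | ⟨g₀, hg₀⟩
  · have h0 : ∀ y : F, y = 0 := fun y =>
      le_antisymm (hG.2 (by simp [lowerBounds]))
        (neg_nonpos.1 (hG.2 (by simp [lowerBounds])))
    refine ⟨{0}, isGLB_singleton, ?_⟩
    rintro _ rfl
    refine ⟨Classical.arbitrary ι, fun α _ => ?_⟩
    show |T (x α) - T f| ≤ 0
    rw [h0 (x α), h0 f]
    simp
  -- Finite infima make `G` directed without changing its infimum; `T '' D` then dominates the image
  -- net.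
  set D := {d | ∃ (s : Finset F) (hs : s.Nonempty), (s : Set F) ⊆ G ∧ d = s.inf' hs id}
  have hGD : G ⊆ D := fun g hg => ⟨{g}, by simp, by simpa using hg, by simp⟩
  have hD : IsGLB D 0 := by
    refine ⟨?_, fun l hl => hG.2 fun g hg => hl (hGD hg)⟩
    rintro _ ⟨s, hs, hsG, rfl⟩
    exact Finset.le_inf' _ _ fun g hg => hG.1 (hsG hg)
  refine ⟨T '' D, ⟨?_, fun l hl => ?_⟩, ?_⟩
  · rintro _ ⟨d, hd, rfl⟩
    exact hT d (hD.1 hd)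
  · exact h D ⟨g₀, hGD hg₀⟩ (directedOn_finset_inf' G) hD l fun d hd => hl ⟨d, hd, rfl⟩
  · rintro _ ⟨_, ⟨s, hs, hsG, rfl⟩, rfl⟩
    have hev : ∃ α₀, ∀ α, α₀ ≤ α → ∀ g ∈ s, |x α - f| ≤ g := by
      clear hs
      induction s using Finset.induction_on with
      | empty => exact ⟨Classical.arbitrary ι, by simp⟩
      | insert a s _ ih =>
        rw [Finset.coe_insert, Set.insert_subset_iff] at hsG
        obtain ⟨α₁, h₁⟩ := ih hsG.2
        obtain ⟨α₂, h₂⟩ := hx a hsG.1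
        obtain ⟨α₃, h₃, h₄⟩ := directed_of (· ≤ ·) α₁ α₂
        refine ⟨α₃, fun α hα g hg => ?_⟩
        rcases Finset.mem_insert.1 hg with rfl | hg
        · exact h₂ α (h₄.trans hα)
        · exact h₁ α (h₃.trans hα) g hg
    obtain ⟨α₀, hα₀⟩ := hev
    refine ⟨α₀, fun α hα => ?_⟩
    have hle : |x α - f| ≤ s.inf' hs id := Finset.le_inf' _ _ fun g hg => hα₀ α hα g hg
    rw [← map_sub]
    refine abs_le'.2 ⟨map_mono_of_nonneg hT ((le_abs_self _).trans hle), ?_⟩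
    rw [← map_neg]
    exact map_mono_of_nonneg hT ((neg_le_abs _).trans hle)

end PositiveMap

/-! ### Ideals, regularity and restriction of operators. -/

section Sublattices

variable {F : Type u} [AddCommGroup F] [Lattice F] [IsOrderedAddMonoid F] [Module ℝ F]

instance (H : Sublat F) : IsOrderedAddMonoid H.toSubmodule where
  add_le_add_left a b h c := by
    have h' : (a : F) ≤ b := h
    exact add_le_add_left h' (c : F)

theorem Sublat.abs_mem (H : Sublat F) {f : F} (hf : f ∈ H.toSubmodule) : |f| ∈ H.toSubmodule :=
  H.sup_mem hf (H.toSubmodule.neg_mem hf)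

theorem idealGen_isIdeal (G : Set F) : (idealGen G).IsIdeal :=
  fun f g hg hfg I hI hG => hI f g (hg I hI hG) hfg

theorem subset_idealGen (G : Set F) : G ⊆ (idealGen G).toSubmodule :=
  fun _ hg _ _ hG => hG hg

theorem mem_principalIdeal_abs (f : F) : f ∈ (principalIdeal |f|).toSubmodule :=
  idealGen_isIdeal _ f |f| (subset_idealGen _ rfl) (abs_abs f).ge

/-- If `l` is a lower bound in `F`, then `l ⊔ 0` lies below an element of the ideal, so it is a
lower bound inside the ideal. -/
theorem Sublat.IsIdeal.isRegular {I : Sublat F} (hI : I.IsIdeal) : I.IsRegular := by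
  rintro G ⟨g₀, hg₀⟩ hG
  refine ⟨?_, fun l hl => ?_⟩
  · rintro _ ⟨g, hg, rfl⟩
    exact hG.1 hg
  · have hle : ∀ g ∈ G, l ⊔ 0 ≤ (g : F) := fun g hg => sup_le (hl ⟨g, hg, rfl⟩) (hG.1 hg)
    have hmem : l ⊔ 0 ∈ I.toSubmodule := by
      refine hI _ g₀ g₀.2 ?_
      rw [abs_of_nonneg (le_sup_right : (0 : F) ≤ l ⊔ 0)]
      exact (hle g₀ hg₀).trans (le_abs_self _)
    have : (⟨l ⊔ 0, hmem⟩ : I.toSubmodule) ≤ 0 := hG.2 fun g hg => hle g hg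
    exact le_sup_left.trans (show l ⊔ 0 ≤ 0 from this)

/-- The whole space as a sublattice. -/
def Sublat.whole : Sublat F where
  toSubmodule := ⊤
  sup_mem _ _ := trivial
  inf_mem _ _ := trivial

theorem Sublat.whole_isIdeal : (Sublat.whole : Sublat F).IsIdeal := fun _ _ _ _ => trivial

theorem IsOrderContinuous.domRestrict {E : Type v} [AddCommGroup E] [Lattice E] [IsOrderedAddMonoid E]
    [Module ℝ E] {T : F →ₗ[ℝ] E} (hT : IsOrderContinuous T) {H : Sublat F} (hH : H.IsRegular) :
    IsOrderContinuous (T.domRestrict H.toSubmodule) := by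
  rintro ι _ _ _ x f ⟨G, hG, hx⟩
  rcases G.eq_empty_or_nonempty with rfl | hne
  · have h0 : ∀ y : H.toSubmodule, y = 0 := fun y =>
      le_antisymm (hG.2 (by simp [lowerBounds]))
        (neg_nonpos.1 (hG.2 (by simp [lowerBounds])))
    refine ⟨{0}, isGLB_singleton, ?_⟩
    rintro _ rfl
    refine ⟨Classical.arbitrary ι, fun α _ => ?_⟩
    show |T.domRestrict H.toSubmodule (x α) - T.domRestrict H.toSubmodule f| ≤ 0
    rw [h0 (x α), h0 f]
    simp
  · refine hT ι (fun α => (x α : F)) f ⟨_, hH G hne hG, ?_⟩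
    rintro _ ⟨g, hg, rfl⟩
    obtain ⟨α₀, h⟩ := hx g hg
    exact ⟨α₀, fun α hα => h α hα⟩

theorem IsOrderContinuous.nonpos_of_le_map_domRestrict {E : Type v} [AddCommGroup E] [Lattice E]
    [IsOrderedAddMonoid E] [Module ℝ E] {T : F →ₗ[ℝ] E} {H : Sublat F}
    (hT : IsOrderContinuous (T.domRestrict H.toSubmodule)) {D : Set F} (hDH : D ⊆ H.toSubmodule)
    (hne : D.Nonempty) (hdir : DirectedOn (· ≥ ·) D) (hD : IsGLB D 0) {l : E}
    (hl : ∀ d ∈ D, l ≤ T d) : l ≤ 0 := by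
  refine hT.nonpos_of_le_map (D := Subtype.val ⁻¹' D) ?_ ?_ ⟨?_, ?_⟩ (fun d hd => hl d hd)
  · obtain ⟨d, hd⟩ := hne
    exact ⟨⟨d, hDH hd⟩, hd⟩
  · intro a ha b hb
    obtain ⟨c, hc, h1, h2⟩ := hdir _ ha _ hb
    exact ⟨⟨c, hDH hc⟩, hc, h1, h2⟩
  · exact fun d hd => hD.1 hd
  · exact fun k hk => show (k : F) ≤ 0 from
      hD.2 fun d hd => show (k : F) ≤ d from hk (show (⟨d, hDH hd⟩ : H.toSubmodule) ∈ _ from hd)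

variable [IsOrderedModule ℝ F]

/-- A solid set which is closed under addition is a sublattice. -/
def Sublat.ofSolid (A : Set F) (zero : (0 : F) ∈ A) (add : ∀ {a b : F}, a ∈ A → b ∈ A → a + b ∈ A)
    (solid : ∀ f g : F, g ∈ A → |f| ≤ |g| → f ∈ A) : Sublat F :=
  have abs : ∀ {a : F}, a ∈ A → |a| ∈ A := fun {a} ha => solid _ a ha (abs_abs a).le
  have nonneg_le : ∀ {f g : F}, g ∈ A → |f| ≤ g → f ∈ A := fun {_ g} hg h =>
    solid _ g hg (h.trans (le_abs_self g))
  have neg : ∀ {a : F}, a ∈ A → -a ∈ A := fun {a} ha => solid _ a ha (abs_neg a).le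
  have sup : ∀ {a b : F}, a ∈ A → b ∈ A → a ⊔ b ∈ A := fun {a b} ha hb =>
    nonneg_le (add (abs ha) (abs hb)) (abs_sup_le a b)
  { carrier := A
    add_mem' := add
    zero_mem' := zero
    smul_mem' := fun c a ha => by
      obtain ⟨n, hn⟩ := exists_nat_ge |c|
      have hmem : ∀ m : ℕ, m • |a| ∈ A := by
        intro m
        induction m with
        | zero => simpa using zero
        | succ m ih => rw [succ_nsmul]; exact add ih (abs ha)
      refine nonneg_le (hmem n) ((abs_smul_le c a).trans ?_)
      rw [← Nat.cast_smul_eq_nsmul ℝ]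
      exact smul_le_smul_of_nonneg_right hn (abs_nonneg a)
    sup_mem := sup
    inf_mem := fun {a b} ha hb => by
      have : a ⊓ b = -(-a ⊔ -b) := by rw [neg_sup, neg_neg, neg_neg]
      rw [this]
      exact neg (sup (neg ha) (neg hb)) }

end Sublattices

/-! ### Uniform approximation and closure. -/

section UniformClosure

variable {F : Type u} [AddCommGroup F] [Lattice F] [IsOrderedAddMonoid F] [Module ℝ F]
  [IsOrderedModule ℝ F]

/-- `f` can be approximated by elements of `A` relative to some `e ≥ 0`. -/
def IsUniformlyApproximable (A : Set F) (f : F) : Prop :=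
  ∃ e : F, 0 ≤ e ∧ ∀ ε : ℝ, 0 < ε → ∃ a ∈ A, |f - a| ≤ ε • e

theorem isUniformlyClosed_of_approximable {A : Set F}
    (h : ∀ f, IsUniformlyApproximable A f → f ∈ A) : IsUniformlyClosed A := by
  refine Set.Subset.antisymm ?_ fun f hf => ?_
  · rintro f ⟨ι, _, _, _, x, hx, e, he, -, hc⟩
    refine h f ⟨e, he, fun ε hε => ?_⟩
    obtain ⟨α, hα⟩ := hc ε hε
    exact ⟨x α, hx α, hα α le_rfl⟩
  · refine ⟨PUnit, inferInstance, inferInstance, inferInstance, fun _ => f, fun _ => hf, |f|,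
      abs_nonneg f, mem_principalIdeal_abs f, fun ε hε => ⟨PUnit.unit, fun _ _ => ?_⟩⟩
    simpa using smul_nonneg hε.le (abs_nonneg f)

/-- The induction principle for density: a property of all elements of `A` that survives uniform
approximation holds on all of `F`. -/
theorem IsTopologicallyDense.mem_of_approximable {A C : Set F} (hA : IsTopologicallyDense A)
    (hAC : A ⊆ C) (h : ∀ f, IsUniformlyApproximable C f → f ∈ C) (f : F) : f ∈ C := by
  have : f ∈ uniformClosure A := by rw [hA]; trivial
  exact this C ⟨isUniformlyClosed_of_approximable h, hAC⟩

theorem IsTopologicallyDense.mono {A B : Set F} (hA : IsTopologicallyDense A) (h : A ⊆ B) :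
    IsTopologicallyDense B :=
  Set.eq_univ_of_univ_subset fun f _ C hC => by
    have : f ∈ uniformClosure A := by rw [hA]; trivial
    exact this C ⟨hC.1, h.trans hC.2⟩

theorem isTopologicallyDense_univ : IsTopologicallyDense (Set.univ : Set F) :=
  Set.eq_univ_of_univ_subset fun f _ _ hC => hC.2 (Set.mem_univ f)

theorem IsTopologicallyDense.isTopologicallyMajorizing {A : Set F} (hA : IsTopologicallyDense A) :
    IsTopologicallyMajorizing A :=
  hA.mono (subset_idealGen A)

/-- The uniformly approximable elements of a sublattice form a sublattice. -/
def Sublat.adherence (K : Sublat F) : Sublat F where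
  carrier := {f | IsUniformlyApproximable (K.toSubmodule : Set F) f}
  zero_mem' := ⟨0, le_rfl, fun ε _ => ⟨0, K.toSubmodule.zero_mem, by simp⟩⟩
  add_mem' := by
    rintro f g ⟨e, he, h⟩ ⟨e', he', h'⟩
    refine ⟨e + e', add_nonneg he he', fun ε hε => ?_⟩
    obtain ⟨a, ha, hfa⟩ := h ε hε
    obtain ⟨b, hb, hgb⟩ := h' ε hε
    refine ⟨a + b, K.toSubmodule.add_mem ha hb, ?_⟩
    rw [add_sub_add_comm, smul_add]
    exact (abs_add_le _ _).trans (add_le_add hfa hgb)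
  smul_mem' := by
    rintro c f ⟨e, he, h⟩
    refine ⟨|c| • e, smul_nonneg (abs_nonneg c) he, fun ε hε => ?_⟩
    obtain ⟨a, ha, hfa⟩ := h ε hε
    refine ⟨c • a, K.toSubmodule.smul_mem c ha, ?_⟩
    rw [← smul_sub, smul_comm]
    exact (abs_smul_le _ _).trans (smul_le_smul_of_nonneg_left hfa (abs_nonneg c))
  sup_mem := by
    rintro f g ⟨e, he, h⟩ ⟨e', he', h'⟩
    refine ⟨e + e', add_nonneg he he', fun ε hε => ?_⟩
    obtain ⟨a, ha, hfa⟩ := h ε hε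
    obtain ⟨b, hb, hgb⟩ := h' ε hε
    refine ⟨a ⊔ b, K.sup_mem ha hb, ?_⟩
    rw [smul_add]
    exact (abs_sup_sub_sup_le _ _ _ _).trans (add_le_add hfa hgb)
  inf_mem := by
    rintro f g ⟨e, he, h⟩ ⟨e', he', h'⟩
    refine ⟨e + e', add_nonneg he he', fun ε hε => ?_⟩
    obtain ⟨a, ha, hfa⟩ := h ε hε
    obtain ⟨b, hb, hgb⟩ := h' ε hε
    refine ⟨a ⊓ b, K.inf_mem ha hb, ?_⟩
    have hinf : f ⊓ g - a ⊓ b = -((-f) ⊔ (-g) - (-a) ⊔ (-b)) := by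
      rw [← neg_inf, ← neg_inf]; abel
    rw [smul_add, hinf, abs_neg]
    refine (abs_sup_sub_sup_le _ _ _ _).trans (add_le_add ?_ ?_)
    · rwa [← abs_neg, neg_sub, sub_neg_eq_add, neg_add_eq_sub]
    · rwa [← abs_neg, neg_sub, sub_neg_eq_add, neg_add_eq_sub]

theorem Sublat.subset_adherence (K : Sublat F) :
    (K.toSubmodule : Set F) ⊆ K.adherence.toSubmodule :=
  fun f hf => ⟨0, le_rfl, fun ε _ => ⟨f, hf, by simp⟩⟩

end UniformClosure

/-! ### Topologically dense regular sublattices are order dense. -/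

section OrderDensity

variable {F : Type u} [AddCommGroup F] [Lattice F] [IsOrderedAddMonoid F] [Module ℝ F]
  [IsOrderedModule ℝ F]

/-- Every strictly positive element of `K` dominates a strictly positive element of `H`. -/
def Sublat.IsOrderDenseIn (H K : Sublat F) : Prop :=
  ∀ f ∈ K.toSubmodule, 0 < f → ∃ h ∈ H.toSubmodule, 0 < h ∧ h ≤ f

theorem pos_sup_zero {p : F} (h : ¬ p ≤ 0) : 0 < p ⊔ 0 :=
  lt_of_le_of_ne le_sup_right fun h' => h (le_sup_left.trans h'.ge)

/-- An order dense sublattice `H` determines every `w ∈ K` with `0 ≤ w ≤ h ∈ H` from above. -/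
theorem Sublat.IsOrderDenseIn.le_of_forall_le (hF : IsArchimedean F) {H K : Sublat F}
    (hd : H.IsOrderDenseIn K) {w h k : F}
    (hw : w ∈ K.toSubmodule) (hh : h ∈ H.toSubmodule) (hwh : w ≤ h) (hk : k ∈ K.toSubmodule)
    (hle : ∀ h' ∈ H.toSubmodule, w ≤ h' → h' ≤ h → k ≤ h') : k ≤ w := by
  by_contra hkw
  have hr : 0 < k ⊔ w - w :=
    sub_pos.2 (lt_of_le_of_ne le_sup_right fun h' => hkw (le_sup_left.trans h'.ge))
  obtain ⟨q, hq, hq0, hqr⟩ := hd _ (K.toSubmodule.sub_mem (K.sup_mem hk hw) hw) hr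
  -- If `n • q ≤ h - w`, then `h - n • q` is an element of `H` between `w` and `h`, hence above `k`.
  -- So `n • q ≤ h - k ⊔ w`, and `q ≤ k ⊔ w - w` leaves room for one more `q`.
  have key : ∀ n : ℕ, n • q ≤ h - w := by
    intro n
    induction n with
    | zero => simpa using hwh
    | succ n ih =>
      have h1 : w ≤ h - n • q := le_sub_comm.1 ih
      have h2 : k ≤ h - n • q := hle _ (H.toSubmodule.sub_mem hh (H.toSubmodule.nsmul_mem hq n)) h1
        (sub_le_self _ (nsmul_nonneg hq0.le n))
      have h3 : n • q ≤ h - k ⊔ w := le_sub_comm.1 (sup_le h2 h1)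
      rw [succ_nsmul]
      simpa using add_le_add h3 hqr
  exact hq0.not_ge (hF.nonpos_of_nsmul_le (sub_nonneg.2 hwh) key)

/-- If `K` misses `(0, f]`, the positive parts of the approximants of `f` have infimum `0` in `K`,
as any lower bound in `K` is at most `f`. Regularity carries this to `F`, where `f - δ • e` is a
lower bound; a `δ` with `f ≰ δ • e` gives a contradiction. -/
theorem Sublat.IsRegular.isOrderDenseIn_adherence (hF : IsArchimedean F) {K : Sublat F}
    (hK : K.IsRegular) : K.IsOrderDenseIn K.adherence := by
  rintro f ⟨e, he, happ⟩ hf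
  by_contra! hno
  obtain ⟨δ, hδ, hfδ⟩ : ∃ δ : ℝ, 0 < δ ∧ ¬ f ≤ δ • e := by
    by_contra! h
    exact hf.not_ge (hF.nonpos_of_forall_le he h)
  let U : Set K.toSubmodule :=
    {h | ∃ a ∈ K.toSubmodule, ∃ ε : ℝ, 0 < ε ∧ ε ≤ δ ∧ |f - a| ≤ ε • e ∧ (h : F) = a ⊔ 0}
  have hU : ∀ ε : ℝ, 0 < ε → ε ≤ δ → ∃ h ∈ U, (h : F) ≤ f + ε • e := by
    intro ε hε hεδ
    obtain ⟨a, ha, hfa⟩ := happ ε hε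
    exact ⟨⟨a ⊔ 0, K.sup_mem ha K.toSubmodule.zero_mem⟩, ⟨a, ha, ε, hε, hεδ, hfa, rfl⟩,
      sup_le (le_of_abs_sub_le_right hfa) (add_nonneg hf.le (smul_nonneg hε.le he))⟩
  have hglb : IsGLB U 0 := by
    refine ⟨?_, fun l hl => ?_⟩
    · rintro h ⟨a, -, -, -, -, -, ha⟩
      show (0 : F) ≤ h
      rw [ha]
      exact le_sup_right
    · have hlf : (l : F) ≤ f := by
        refine sub_nonpos.1 (hF.nonpos_of_forall_le he fun ε hε => ?_)
        obtain ⟨h, hhU, hh⟩ := hU (min ε δ) (lt_min hε hδ) (min_le_right _ _)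
        have : (l : F) ≤ h := hl hhU
        exact (sub_le_iff_le_add'.2 (this.trans hh)).trans
          (smul_le_smul_of_nonneg_right (min_le_left _ _) he)
      by_contra hl0
      exact hno _ (K.sup_mem l.2 K.toSubmodule.zero_mem) (pos_sup_zero (p := (l : F)) hl0)
        (sup_le hlf hf.le)
  obtain ⟨h₀, hh₀, -⟩ := hU δ hδ le_rfl
  refine hfδ (sub_nonpos.1 ((hK U ⟨h₀, hh₀⟩ hglb).2 ?_))
  rintro _ ⟨h, ⟨a, ha, ε, hε, hεδ, hfa, hha⟩, rfl⟩
  show f - δ • e ≤ h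
  rw [hha]
  exact (sub_le_sub_left (smul_le_smul_of_nonneg_right hεδ he) f).trans
    ((le_of_abs_sub_le_left hfa).trans le_sup_left)

/-- A positive lower bound `p` of `V` in `F` is shown disjoint from `H`, hence by density from
itself. -/
theorem Sublat.IsRegular.of_isOrderDenseIn (hF : IsArchimedean F) {H K : Sublat F}
    (hH : H.IsRegular) (hdense : IsTopologicallyDense (H.toSubmodule : Set F))
    (hHK : (H.toSubmodule : Set F) ⊆ K.toSubmodule) (hd : H.IsOrderDenseIn K) :
    K.IsRegular := by
  rintro V ⟨v₀, hv₀⟩ hV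
  refine ⟨?_, fun f hf => ?_⟩
  · rintro _ ⟨v, hv, rfl⟩
    exact hV.1 hv
  have hV0 : ∀ v ∈ V, (0 : F) ≤ v := fun v hv => hV.1 hv
  have hp : ∀ v ∈ V, f ⊔ 0 ≤ (v : F) := fun v hv => sup_le (hf ⟨v, hv, rfl⟩) (hV0 v hv)
  have hp0 : 0 ≤ f ⊔ 0 := le_sup_right
  refine le_sup_left.trans (b := f ⊔ 0) ?_
  generalize f ⊔ 0 = p at hp hp0 ⊢
  have hdisj : ∀ h ∈ H.toSubmodule, 0 ≤ h → p ⊓ h ≤ 0 := by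
    intro h hh h0
    -- `U` moves the family `v ⊓ h` into `H`, where regularity applies; order density ensures that a
    -- lower bound of `U` in `H` is below every `v ⊓ h`.
    let U : Set H.toSubmodule := {h' | ∃ v ∈ V, (v : F) ⊓ h ≤ h'}
    have hU : IsGLB U 0 := by
      refine ⟨?_, fun k hk => ?_⟩
      · rintro h' ⟨v, hv, hvh⟩
        exact (le_inf (hV0 v hv) h0).trans hvh
      · have hkv : ∀ v ∈ V, (k : F) ≤ v := fun v hv =>
          (hd.le_of_forall_le hF (K.inf_mem v.2 (hHK hh)) hh inf_le_right (hHK k.2)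
            fun h' hh' hle _ => show (k : F) ≤ h' from
              hk (show (⟨h', hh'⟩ : H.toSubmodule) ∈ U from ⟨v, hv, hle⟩)).trans inf_le_left
        exact show (k : F) ≤ 0 from hV.2 (show (⟨k, hHK k.2⟩ : K.toSubmodule) ∈ _ from hkv)
    refine (hH U ⟨⟨h, hh⟩, v₀, hv₀, inf_le_right⟩ hU).2 ?_
    rintro _ ⟨h', ⟨v, hv, hle⟩, rfl⟩
    exact (inf_le_inf (hp v hv) le_rfl).trans hle
  have hmem := hdense.mem_of_approximable (C := {v | p ⊓ |v| ≤ 0})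
    (fun h hh => hdisj _ (H.abs_mem hh) (abs_nonneg h)) (by
      rintro v ⟨e, he, happ⟩
      refine hF.nonpos_of_forall_le he fun ε hε => ?_
      obtain ⟨a, ha, hva⟩ := happ ε hε
      exact (inf_abs_le_inf_abs_add hp0 v a).trans
        ((add_le_add ha hva).trans (zero_add _).le)) p
  simpa [abs_of_nonneg hp0] using hmem

/-- The union of a nonempty chain of sublattices is a sublattice. -/
def Sublat.unionOfChain (c : Set (Set F)) (hc : IsChain (· ⊆ ·) c) (hne : c.Nonempty)
    (hsub : ∀ S ∈ c, ∃ K : Sublat F, (K.toSubmodule : Set F) = S) : Sublat F :=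
  have pair : ∀ {a b : F}, a ∈ ⋃₀ c → b ∈ ⋃₀ c →
      ∃ K : Sublat F, (K.toSubmodule : Set F) ⊆ ⋃₀ c ∧ a ∈ K.toSubmodule ∧ b ∈ K.toSubmodule := by
    rintro a b ⟨S, hS, ha⟩ ⟨S', hS', hb⟩
    rcases hc.total hS hS' with h | h
    · obtain ⟨K, rfl⟩ := hsub S' hS'
      exact ⟨K, Set.subset_sUnion_of_mem hS', h ha, hb⟩
    · obtain ⟨K, rfl⟩ := hsub S hS
      exact ⟨K, Set.subset_sUnion_of_mem hS, ha, h hb⟩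
  { carrier := ⋃₀ c
    zero_mem' := by
      obtain ⟨S, hS⟩ := hne
      obtain ⟨K, rfl⟩ := hsub S hS
      exact ⟨_, hS, K.toSubmodule.zero_mem⟩
    add_mem' := fun ha hb => by
      obtain ⟨K, hK, ha, hb⟩ := pair ha hb
      exact hK (K.toSubmodule.add_mem ha hb)
    smul_mem' := fun r a ha => by
      obtain ⟨K, hK, ha, -⟩ := pair ha ha
      exact hK (K.toSubmodule.smul_mem r ha)
    sup_mem := fun ha hb => by
      obtain ⟨K, hK, ha, hb⟩ := pair ha hb
      exact hK (K.sup_mem ha hb)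
    inf_mem := fun ha hb => by
      obtain ⟨K, hK, ha, hb⟩ := pair ha hb
      exact hK (K.inf_mem ha hb) }

/-- A topologically dense regular sublattice is order dense. -/
theorem Sublat.IsRegular.isOrderDense (hF : IsArchimedean F) {H : Sublat F} (hH : H.IsRegular)
    (hdense : IsTopologicallyDense (H.toSubmodule : Set F)) : H.IsOrderDense := by
  obtain ⟨S, hHS, hmax⟩ := zorn_subset_nonempty
    {S : Set F | ∃ K : Sublat F, (K.toSubmodule : Set F) = S ∧ H.IsOrderDenseIn K}
    (by
      intro c hc hchain hne
      refine ⟨⋃₀ c, ⟨unionOfChain c hchain hne fun S hS => ?_, rfl, ?_⟩,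
        fun S hS => Set.subset_sUnion_of_mem hS⟩
      · obtain ⟨K, hK, -⟩ := hc hS
        exact ⟨K, hK⟩
      · rintro f ⟨S, hS, hfS⟩ hf
        obtain ⟨K, rfl, hK⟩ := hc hS
        exact hK f hfS hf)
    (H.toSubmodule : Set F) ⟨H, rfl, fun f hf h0 => ⟨f, hf, h0, le_rfl⟩⟩
  obtain ⟨K, rfl, hK⟩ := hmax.prop
  have hKreg : K.IsRegular := hH.of_isOrderDenseIn hF hdense hHS hK
  have hadh : H.IsOrderDenseIn K.adherence := by
    intro f hf h0
    obtain ⟨k, hk, hk0, hkf⟩ := hKreg.isOrderDenseIn_adherence hF f hf h0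
    obtain ⟨h, hh, hh0, hhk⟩ := hK k hk hk0
    exact ⟨h, hh, hh0, hhk.trans hkf⟩
  have hsub : (K.adherence.toSubmodule : Set F) ⊆ K.toSubmodule :=
    hmax.le_of_ge ⟨K.adherence, rfl, hadh⟩ K.subset_adherence
  exact fun f hf => hK f (hdense.mem_of_approximable hHS (fun g hg => hsub hg) f) hf

end OrderDensity

/-! ### The absorbed elements and the return to order continuity. -/

section Absorption

variable {F : Type u} {E : Type v}
  [AddCommGroup F] [Lattice F] [IsOrderedAddMonoid F] [Module ℝ F] [IsOrderedModule ℝ F]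
  [AddCommGroup E] [Lattice E] [IsOrderedAddMonoid E] [Module ℝ E] {T : F →ₗ[ℝ] E}

/-- The ideal of those `f` for which `⋀ T (d ⊓ |f|) = 0` whenever `d` decreases to `0`. -/
def nullIdeal (T : F →ₗ[ℝ] E) (hT : ∀ f : F, 0 ≤ f → 0 ≤ T f) : Sublat F :=
  Sublat.ofSolid
    {f | ∀ D : Set F, D.Nonempty → DirectedOn (· ≥ ·) D → IsGLB D 0 →
      ∀ l : E, (∀ d ∈ D, l ≤ T (d ⊓ |f|)) → l ≤ 0}
    (by
      rintro D ⟨d, hd⟩ - hD l hl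
      simpa [inf_eq_right.2 (hD.1 hd)] using hl d hd)
    (by
      intro a b ha hb D hne hdir hD l hl
      -- Directedness decouples the two indices, so the infima over `d` and `d'` can be taken one
      -- after the other.
      have hab : ∀ d ∈ D, ∀ d' ∈ D, l ≤ T (d ⊓ |a|) + T (d' ⊓ |b|) := by
        intro d hd d' hd'
        obtain ⟨c, hc, hcd, hcd'⟩ := hdir d hd d' hd'
        refine (hl c hc).trans ?_
        rw [← map_add]
        refine map_mono_of_nonneg hT ?_
        calc c ⊓ |a + b| ≤ c ⊓ (|a| + |b|) := inf_le_inf le_rfl (abs_add_le a b)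
          _ ≤ c ⊓ |a| + c ⊓ |b| :=
            inf_add_le_add_inf (hD.1 hc) (abs_nonneg a) (abs_nonneg b)
          _ ≤ d ⊓ |a| + d' ⊓ |b| :=
            add_le_add (inf_le_inf hcd le_rfl) (inf_le_inf hcd' le_rfl)
      refine hb D hne hdir hD l fun d' hd' => sub_nonpos.1 ?_
      exact ha D hne hdir hD _ fun d hd => sub_le_iff_le_add.2 (hab d hd d' hd'))
    (by
      intro f g hg hfg D hne hdir hD l hl
      exact hg D hne hdir hD l fun d hd =>
        (hl d hd).trans (map_mono_of_nonneg hT (inf_le_inf le_rfl hfg)))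

theorem nullIdeal_isIdeal (hT : ∀ f : F, 0 ≤ f → 0 ≤ T f) : (nullIdeal T hT).IsIdeal := by
  intro f g hg hfg D hne hdir hD l hl
  exact hg D hne hdir hD l fun d hd =>
    (hl d hd).trans (map_mono_of_nonneg hT (inf_le_inf le_rfl hfg))

theorem isOrderContinuous_of_subset_nullIdeal [IsOrderedModule ℝ E] (hE : IsArchimedean E)
    (hT : ∀ f : F, 0 ≤ f → 0 ≤ T f) {G : Set F} (hG : IsTopologicallyMajorizing G)
    (hGT : G ⊆ (nullIdeal T hT).toSubmodule) : IsOrderContinuous T := by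
  have hall := hG.mem_of_approximable (C := (nullIdeal T hT).toSubmodule)
    (fun f hf => hf _ (nullIdeal_isIdeal hT) hGT) (by
      rintro f ⟨e, he, happ⟩ D hne hdir hD l hl
      refine hE.nonpos_of_forall_le (hT e he) fun ε hε => ?_
      obtain ⟨a, ha, hfa⟩ := happ ε hε
      refine sub_nonpos.1 (ha D hne hdir hD _ fun d hd => sub_le_iff_le_add.2 ?_)
      refine (hl d hd).trans ?_
      rw [← map_smul, ← map_add]
      exact map_mono_of_nonneg hT
        ((inf_abs_le_inf_abs_add (hD.1 hd) f a).trans (add_le_add le_rfl hfa)))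
  refine isOrderContinuous_of_directed hT fun D hne hdir hD l hl => ?_
  obtain ⟨d₀, hd₀⟩ := hne
  refine hall d₀ D ⟨d₀, hd₀⟩ hdir hD l fun d hd => ?_
  obtain ⟨c, hc, hcd, hcd₀⟩ := hdir d hd d₀ hd₀
  exact (hl c hc).trans (map_mono_of_nonneg hT (le_inf hcd (hcd₀.trans (le_abs_self d₀))))

theorem mem_nullIdeal_of_principalIdeal (hT : ∀ f : F, 0 ≤ f → 0 ≤ T f) {g : F} (hg : 0 ≤ g)
    (h : IsOrderContinuous (T.domRestrict (principalIdeal g).toSubmodule)) :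
    g ∈ (nullIdeal T hT).toSubmodule := by
  intro D hne hdir hD l hl
  rw [abs_of_nonneg hg] at hl
  refine h.nonpos_of_le_map_domRestrict (D := (· ⊓ g) '' D) ?_ (hne.image _) ?_ ⟨?_, ?_⟩
    (by rintro _ ⟨d, hd, rfl⟩; exact hl d hd)
  · rintro _ ⟨d, hd, rfl⟩
    refine idealGen_isIdeal {g} _ g (subset_idealGen _ rfl) ?_
    rw [abs_of_nonneg (le_inf (hD.1 hd) hg), abs_of_nonneg hg]
    exact inf_le_right
  · rintro _ ⟨a, ha, rfl⟩ _ ⟨b, hb, rfl⟩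
    obtain ⟨c, hc, hca, hcb⟩ := hdir a ha b hb
    exact ⟨_, ⟨c, hc, rfl⟩, inf_le_inf hca le_rfl, inf_le_inf hcb le_rfl⟩
  · rintro _ ⟨d, hd, rfl⟩
    exact le_inf (hD.1 hd) hg
  · exact fun k hk => hD.2 fun d hd => (hk ⟨d, hd, rfl⟩).trans inf_le_left

theorem subset_nullIdeal_of_isOrderDense (hF : IsArchimedean F) (hT : ∀ f : F, 0 ≤ f → 0 ≤ T f)
    {H : Sublat F} (hH : H.IsOrderDense) (h : IsOrderContinuous (T.domRestrict H.toSubmodule)) :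
    (H.toSubmodule : Set F) ⊆ (nullIdeal T hT).toSubmodule := by
  intro f hf D hne hdir hD l hl
  have hf' := H.abs_mem hf
  have hd : H.IsOrderDenseIn Sublat.whole := fun g _ hg => hH g hg
  refine h.nonpos_of_le_map_domRestrict
    -- The elements `d ⊓ |f|` need not lie in `H`; their majorants in `H` form a directed set, still
    -- with infimum `0` because those below `|f|` already determine `d ⊓ |f|` from above.
    (D := {b | b ∈ H.toSubmodule ∧ ∃ d ∈ D, d ⊓ |f| ≤ b}) (fun b hb => hb.1) ?_ ?_ ⟨?_, ?_⟩ ?_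
  · obtain ⟨d, hd⟩ := hne
    exact ⟨|f|, hf', d, hd, inf_le_right⟩
  · rintro a ⟨ha, d, hd, hda⟩ b ⟨hb, d', hd', hdb⟩
    obtain ⟨c, hc, hcd, hcd'⟩ := hdir d hd d' hd'
    exact ⟨a ⊓ b, ⟨H.inf_mem ha hb, c, hc, le_inf ((inf_le_inf hcd le_rfl).trans hda)
      ((inf_le_inf hcd' le_rfl).trans hdb)⟩, inf_le_left, inf_le_right⟩
  · rintro b ⟨-, d, hd, hdb⟩
    exact (le_inf (hD.1 hd) (abs_nonneg f)).trans hdb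
  · intro k hk
    refine hD.2 fun d hdD => ?_
    exact (hd.le_of_forall_le hF (w := d ⊓ |f|) trivial hf' inf_le_right trivial
      fun b hb hdb _ => hk ⟨hb, d, hdD, hdb⟩).trans inf_le_left
  · rintro b ⟨-, d, hd, hdb⟩
    exact (hl d hd).trans (map_mono_of_nonneg hT hdb)

end Absorption

end VecLat

/-- For a positive operator between Archimedean vector lattices, order continuity is equivalent to
order continuity on the principal ideals of a topologically majorizing set, on an order dense
topologically majorizing sublattice, and on a topologically dense regular sublattice, the
topological notions being those of the uniform convergence. -/
theorem corollary9p2 {F : Type u} {E : Type v}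
    [AddCommGroup F] [Lattice F] [IsOrderedAddMonoid F] [Module ℝ F] [IsOrderedModule ℝ F]
    [AddCommGroup E] [Lattice E] [IsOrderedAddMonoid E] [Module ℝ E] [IsOrderedModule ℝ E]
    (hF : VecLat.IsArchimedean F) (hE : VecLat.IsArchimedean E)
    (T : F →ₗ[ℝ] E) (hT : ∀ f : F, 0 ≤ f → 0 ≤ T f) :
    List.TFAE
      [VecLat.IsOrderContinuous T,
       ∃ G : Set F, (∀ g ∈ G, 0 ≤ g) ∧ VecLat.IsTopologicallyMajorizing G ∧
         ∀ g ∈ G, VecLat.IsOrderContinuous (T.domRestrict (VecLat.principalIdeal g).toSubmodule),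
       ∃ H : VecLat.Sublat F, H.IsOrderDense ∧
         VecLat.IsTopologicallyMajorizing (H.toSubmodule : Set F) ∧
         VecLat.IsOrderContinuous (T.domRestrict H.toSubmodule),
       ∃ H : VecLat.Sublat F, H.IsRegular ∧
         VecLat.IsTopologicallyDense (H.toSubmodule : Set F) ∧
         VecLat.IsOrderContinuous (T.domRestrict H.toSubmodule)] := by
  have hwhole : VecLat.IsTopologicallyDense
      ((VecLat.Sublat.whole : VecLat.Sublat F).toSubmodule : Set F) :=
    VecLat.isTopologicallyDense_univ
  tfae_have 1 → 2 := fun h =>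
    ⟨{g | 0 ≤ g}, fun _ hg => hg,
      VecLat.isTopologicallyDense_univ.mono fun f _ =>
        VecLat.idealGen_isIdeal _ f |f| (VecLat.subset_idealGen _ (abs_nonneg f)) (abs_abs f).ge,
      fun _ _ => h.domRestrict (VecLat.idealGen_isIdeal _).isRegular⟩
  tfae_have 2 → 1 := fun ⟨_, hG0, hG, hGT⟩ =>
    VecLat.isOrderContinuous_of_subset_nullIdeal hE hT hG fun g hg =>
      VecLat.mem_nullIdeal_of_principalIdeal hT (hG0 g hg) (hGT g hg)
  tfae_have 1 → 4 := fun h =>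
    ⟨VecLat.Sublat.whole, VecLat.Sublat.whole_isIdeal.isRegular, hwhole,
      h.domRestrict VecLat.Sublat.whole_isIdeal.isRegular⟩
  tfae_have 4 → 3 := fun ⟨H, hH, hdense, hHT⟩ =>
    ⟨H, hH.isOrderDense hF hdense, hdense.isTopologicallyMajorizing, hHT⟩
  tfae_have 3 → 1 := fun ⟨_, hH, hmaj, hHT⟩ =>
    VecLat.isOrderContinuous_of_subset_nullIdeal hE hT hmaj
      (VecLat.subset_nullIdeal_of_isOrderDense hF hT hH hHT)
  tfae_finish
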